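/- **Setting.** Let $n,d\ge 1$ and let $X_1,\dots,X_n$ be independent random variables on a probability space $(\Omega,\mathcal E,\mathbb P)$ with values in a measured space $(\mathbb X,\mathcal A,\mu)$, each with density $s$ with respect to $\mu$. For non-negative $\mu$-integrable $f,g$ put $h^2(f,g)=\frac12\int(\sqrt f-\sqrt g)^2\,d\mu$. Let $\Theta=\prod_{j=1}^d[m_j,M_j]\subset\mathbb R^d$ and let $\mathscr F=\{f_\theta:\theta\in\Theta\}$ be a set of probability densities with respect to $\mu$ for which there are positive numbers $\alpha_j,\underline R_j,\overline R_j$ $(1\le j\le d)$ with $$\sup_{1\le j\le d}\underline R_j|\theta_j-\theta_j'|^{\alpha_j}\le h^2(f_\theta,f_{\theta'})\le\sup_{1\le j\le d}\overline R_j|\theta_j-\theta'_j|^{\alpha_j}\qquad\text{for all }\theta,\theta'\in\Theta .$$ Write $h^2(s,\mathscr F)=\inf_{\theta\in\Theta}h^2(s,f_\theta)$, $\operatorname{diam}A=\sup_{\theta,\theta'\in A}h^2(f_\theta,f_{\theta'})$ for $A\subset\Theta$, $\frac1{\bar\alpha}=\frac1d\sum_{j=1}^d\frac1{\alpha_j}$,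 and $\bar\kappa=\Big(1+\sqrt{\tfrac{2+\sqrt2}{2-\sqrt2}}\Big)^{-2}$. For $1\le j\le d$ let $t_j\in(0,d^{1/\alpha_j}]$ and $\epsilon_j=t_j(\overline R_jn)^{-1/\alpha_j}$; let $\pi(\theta)=\big(m_j+\lfloor(\theta_j-m_j)/\epsilon_j\rfloor\epsilon_j\big)_{1\le j\le d}$ and $T(\theta,\theta')=\overline T(f_{\pi(\theta)},f_{\pi(\theta')})$ for $\theta,\theta'\in\Theta$, where (with $0/0=0$) $$\overline T(g,g')=\frac1n\sum_{i=1}^n\frac{\sqrt{g'(X_i)}-\sqrt{g(X_i)}}{\sqrt{g(X_i)+g'(X_i)}}+\frac12\int_{\mathbb X}\sqrt{g+g'}\,\big(\sqrt{g'}-\sqrt g\big)\,d\mu .$$ **Theorem.** Let $\kappa\in(0,\bar\kappa)$ and $\kappa_0>0$. Let $N\ge1$ be an integer and $\Theta_1,\dots,\Theta_N$ non-empty subsets of $\Theta$ with $\Theta_1=\Theta$ ($N$ and the sets may depend on $\omega\in\Omega$, in particular on the observations). Suppose that for every $i\in\{1,\dots,N-1\}$ there are an integer $L_i\ge1$ and,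 for each $\ell\in\{1,\dots,L_i\}$, two elements $\theta^{(i,\ell)}\ne\theta'^{(i,\ell)}$ of $\Theta_i$ (which may also depend on $\omega$) such that $$\Theta_i\setminus\bigcup_{\ell=1}^{L_i}B^{(i,\ell)}\subset\Theta_{i+1}\subset\Theta_i\qquad\text{and}\qquad\kappa_0\operatorname{diam}(\Theta_i)\le\inf_{1\le\ell\le L_i}h^2\big(f_{\theta^{(i,\ell)}},f_{\theta'^{(i,\ell)}}\big),$$ where $B^{(i,\ell)}$ is $A^{(i,\ell)}$ if $T(\theta^{(i,\ell)},\theta'^{(i,\ell)})>0$, $A'^{(i,\ell)}$ if $T(\theta^{(i,\ell)},\theta'^{(i,\ell)})<0$, and $A^{(i,\ell)}\cup A'^{(i,\ell)}$ if $T(\theta^{(i,\ell)},\theta'^{(i,\ell)})=0$, with $$A^{(i,\ell)}=\big\{\theta''\in\Theta_i:\ h^2(f_{\theta''},f_{\theta^{(i,\ell)}})\le\kappa\,h^2(f_{\theta^{(i,\ell)}},f_{\theta'^{(i,\ell)}})\big\},\qquad A'^{(i,\ell)}=\big\{\theta''\in\Theta_i:\ h^2(f_{\theta''},f_{\theta'^{(i,\ell)}})\le\kappa\,h^2(f_{\theta^{(i,\ell)}},f_{\theta'^{(i,\ell)}})\big\}.$$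 Then for all $\xi>0$ $$\mathbb P\Big[\,C\inf_{\theta\in\Theta_N}h^2(s,f_\theta)\ \ge\ h^2(s,\mathscr F)+\frac{D_{\mathscr F}}n+\xi\Big]\le e^{-n\xi},$$ $$D_{\mathscr F}=\max\Big\{d,\ \sum_{j=1}^d\log\Big(1+t_j^{-1}\big((d/\bar\alpha)\,(c\,\overline R_j/\underline R_j)\big)^{1/\alpha_j}\Big)\Big\},$$ where $C>0$ depends only on $\kappa$ and $\kappa_0$, and $c>0$ depends only on $\kappa$. ($\mathbb P$ is read as outer probability if the event is not measurable.) -/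

import Mathlib

open MeasureTheory ProbabilityTheory

noncomputable section

namespace HellingerTest

/-- A probability density with respect to `μ`, as a real-valued function. -/
structure IsDensity {X : Type*} [MeasurableSpace X] (μ : Measure X) (g : X → ℝ) : Prop where
  measurable : Measurable g
  nonneg : ∀ x, 0 ≤ g x
  lintegral_eq_one : ∫⁻ x, ENNReal.ofReal (g x) ∂μ = 1

/-- The squared Hellinger distance `h²(g, g') = (1/2) ∫ (√g - √g')² dμ`. -/
def hellSq {X : Type*} [MeasurableSpace X] (μ : Measure X) (g g' : X → ℝ) : ℝ :=
  (1 / 2) * ∫ x, (√(g x) - √(g' x)) ^ 2 ∂μ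

/-- `inf_{θ ∈ A} h²(s, f_θ)`; for `A` the whole parameter set this is `h²(s, F)`. -/
def infHellSq {X : Type*} [MeasurableSpace X] (μ : Measure X) {d : ℕ} (s : X → ℝ)
    (f : (Fin d → ℝ) → X → ℝ) (A : Set (Fin d → ℝ)) : ℝ :=
  sInf ((fun θ => hellSq μ s (f θ)) '' A)

/-- `diam A = sup_{θ, θ' ∈ A} h²(f_θ, f_θ')`. -/
def hellDiam {X : Type*} [MeasurableSpace X] (μ : Measure X) {d : ℕ}
    (f : (Fin d → ℝ) → X → ℝ) (A : Set (Fin d → ℝ)) : ℝ :=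
  sSup (Set.image2 (fun θ θ' => hellSq μ (f θ) (f θ')) A A)

/-- The family `(f_θ)` of densities indexed by the rectangle `∏ⱼ [mⱼ, Mⱼ]` (which is
`Set.Icc m M`), with the two-sided comparison between `h²(f_θ, f_θ')` and the coordinates. -/
structure IsModel {X : Type*} [MeasurableSpace X] (μ : Measure X) {d : ℕ}
    (f : (Fin d → ℝ) → X → ℝ) (m M α Rlow Rup : Fin d → ℝ) : Prop where
  isDensity : ∀ θ ∈ Set.Icc m M, IsDensity μ (f θ)
  alpha_pos : ∀ j, 0 < α j
  Rlow_pos : ∀ j, 0 < Rlow j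
  Rup_pos : ∀ j, 0 < Rup j
  lower : ∀ θ ∈ Set.Icc m M, ∀ θ' ∈ Set.Icc m M,
    (⨆ j, Rlow j * |θ j - θ' j| ^ α j) ≤ hellSq μ (f θ) (f θ')
  upper : ∀ θ ∈ Set.Icc m M, ∀ θ' ∈ Set.Icc m M,
    hellSq μ (f θ) (f θ') ≤ ⨆ j, Rup j * |θ j - θ' j| ^ α j

/-- The constant `(1 + √((2 + √2) / (2 - √2)))⁻²`. -/
def kappaBar : ℝ := ((1 + √((2 + √2) / (2 - √2))) ^ 2)⁻¹

/-- The mesh `εⱼ = tⱼ (R̄ⱼ n)^(-1/αⱼ)`. -/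
def mesh {d : ℕ} (n : ℕ) (t α Rup : Fin d → ℝ) (j : Fin d) : ℝ :=
  t j * (Rup j * n) ^ (-(1 / α j))

/-- The projection on the grid: `π(θ)ⱼ = mⱼ + ⌊(θⱼ - mⱼ) / εⱼ⌋ εⱼ`. -/
def gridProj {d : ℕ} (m ε : Fin d → ℝ) (θ : Fin d → ℝ) : Fin d → ℝ :=
  fun j => m j + (⌊(θ j - m j) / ε j⌋ : ℝ) * ε j

/-- The functional `T̄(g, g')` evaluated at the sample `x₁, …, xₙ` (with `0 / 0 = 0`). -/
def testStat {X : Type*} [MeasurableSpace X] (μ : Measure X) {n : ℕ} (x : Fin n → X)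
    (g g' : X → ℝ) : ℝ :=
  (1 / n) * ∑ i, (√(g' (x i)) - √(g (x i))) / √(g (x i) + g' (x i))
    + (1 / 2) * ∫ y, √(g y + g' y) * (√(g' y) - √(g y)) ∂μ

/-- The test `T(θ, θ') = T̄(f_{π(θ)}, f_{π(θ')})` at the sample `x₁, …, xₙ`, for the grid of
origin `m` and mesh `ε`. -/
def gridTest {X : Type*} [MeasurableSpace X] (μ : Measure X) {n d : ℕ} (x : Fin n → X)
    (f : (Fin d → ℝ) → X → ℝ) (m ε : Fin d → ℝ) (θ θ' : Fin d → ℝ) : ℝ :=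
  testStat μ x (f (gridProj m ε θ)) (f (gridProj m ε θ'))

/-- `{θ'' ∈ A : h²(f_θ'', f_θ) ≤ r}`, a Hellinger ball inside `A`. -/
def hellBall {X : Type*} [MeasurableSpace X] (μ : Measure X) {d : ℕ}
    (f : (Fin d → ℝ) → X → ℝ) (A : Set (Fin d → ℝ)) (θ : Fin d → ℝ) (r : ℝ) :
    Set (Fin d → ℝ) :=
  {θ'' | θ'' ∈ A ∧ hellSq μ (f θ'') (f θ) ≤ r}

open Classical in
/-- The set that may be removed from `A` after testing `θ` against `θ'`, when the test has the
value `T`: the ball around `θ` if `T > 0`, the ball around `θ'` if `T < 0`, both if `T = 0`. -/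
def removable {X : Type*} [MeasurableSpace X] (μ : Measure X) {d : ℕ}
    (f : (Fin d → ℝ) → X → ℝ) (κ : ℝ) (A : Set (Fin d → ℝ)) (T : ℝ) (θ θ' : Fin d → ℝ) :
    Set (Fin d → ℝ) :=
  if 0 < T then hellBall μ f A θ (κ * hellSq μ (f θ) (f θ'))
  else if T < 0 then hellBall μ f A θ' (κ * hellSq μ (f θ) (f θ'))
  else hellBall μ f A θ (κ * hellSq μ (f θ) (f θ'))
    ∪ hellBall μ f A θ' (κ * hellSq μ (f θ) (f θ'))

/-- The harmonic mean of `α`. -/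
def harmonicMean {d : ℕ} (α : Fin d → ℝ) : ℝ := ((1 / d) * ∑ j, 1 / α j)⁻¹

/-- The dimension term
`max {d, ∑ⱼ log (1 + tⱼ⁻¹ ((d/ᾱ) (c R̄ⱼ / R̲ⱼ))^(1/αⱼ))}`. -/
def dimTerm {d : ℕ} (c : ℝ) (t α Rlow Rup : Fin d → ℝ) : ℝ :=
  max (d : ℝ) (∑ j, Real.log
    (1 + (t j)⁻¹ * ((d / harmonicMean α) * (c * Rup j / Rlow j)) ^ (1 / α j)))

/-- What is required of the sets `Θ₁, …, Θ_N`, given the sample `x₁, …, xₙ`. -/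
structure IsNestedSearch {X : Type*} [MeasurableSpace X] (μ : Measure X) {n d : ℕ}
    (x : Fin n → X) (f : (Fin d → ℝ) → X → ℝ) (m M ε : Fin d → ℝ) (κ κ₀ : ℝ)
    (N : ℕ) (Θ : ℕ → Set (Fin d → ℝ)) : Prop where
  one_le : 1 ≤ N
  nonempty : ∀ i ∈ Set.Icc 1 N, (Θ i).Nonempty
  subset : ∀ i ∈ Set.Icc 1 N, Θ i ⊆ Set.Icc m M
  first : Θ 1 = Set.Icc m M
  step : ∀ i ∈ Set.Ico 1 N, ∃ L : ℕ, 1 ≤ L ∧ ∃ θ θ' : Fin L → Fin d → ℝ,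
    (∀ l, θ l ∈ Θ i ∧ θ' l ∈ Θ i ∧ θ l ≠ θ' l) ∧
    Θ i \ (⋃ l, removable μ f κ (Θ i) (gridTest μ x f m ε (θ l) (θ' l)) (θ l) (θ' l))
      ⊆ Θ (i + 1) ∧
    Θ (i + 1) ⊆ Θ i ∧
    κ₀ * hellDiam μ f (Θ i) ≤ ⨅ l, hellSq μ (f (θ l)) (f (θ' l))

end HellingerTest

end

/-!
The argument compares the tests with their means, uniformly over the grid, and then runs a purely
metric argument on the sets of the search.

*One test.* With `a = √g`, `b = √g'` and `σ = √s`, completing a square and using that `√` is concave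
gives the pointwise bound `score_mean_le`; integrated, it says that the mean of `T̄(g, g')` is at most
`(√2 + 1) h²(s, g) - (√2 - 1) h²(s, g')`. The score is bounded by `1` and its second moment is at most
`6 (h²(s, g) + h²(s, g'))`, so Chernoff's bound with a small fixed parameter `l` shows that the
deviations cost only `6 l (h²(s, g) + h²(s, g'))` and a term `y / (n l)` (`testStat_deviation`).

*All tests at once.* The rectangle may hold arbitrarily many grid points, so the union bound is taken
with levels `y` that contain `n a (h²(s, g) + h²(s, g'))` for a small `a`. What has to be bounded is
then `∑ exp (-n a h²(s, g))` over the grid. By the lower bound on `h²`, in which the supremum over the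
coordinates is replaced by the average with weights proportional to `1 / αⱼ`, this sum is dominated
by a product of one-dimensional sums `∑ exp (-b |k|^α)`, each at most `1 + 8 (2 / (α b))^(1/α)`. The
product is at most the exponential of four times the dimension term (`IsModel.sum_exp_neg_hellSq_le`,
`IsModel.measure_exists_testStat_ge_le`).

*The search.* Let `Z = h²(s, F) + D / n + ξ` and let `θ₀` be a near-minimizer of `h²(s, f_θ)`. On the
event above, a test in favour of `θ'` gives `h(s, f_θ') ≤ q h(s, f_θ) + O(√Z)`, for any fixed
`q > √((√2 + 1) / (√2 - 1)) = 1 + √2`. If `θ₀` lies in the ball around `θ` that may be removed, the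
triangle inequality gives `(1 - √κ (1 + q)) h(f_θ, f_θ') ≤ O(√Z)`, and `κ < κ̄ = (2 + √2)⁻²` is exactly
what makes some `√κ (1 + q) < 1` (`hellSq_le_of_close_to_loser`). So either `θ₀` is never removed, or
at the step where it is removed the whole current set, which contains the last one, has a diameter at
most a constant times `Z / κ₀` (`IsNestedSearch.infHellSq_last_le`).
-/

noncomputable section

namespace HellingerTest

/-! ### The Hellinger distance as an `L²` distance -/

section Hellinger

variable {X : Type*} [MeasurableSpace X] {μ : Measure X} {g g' g'' : X → ℝ}

lemma IsDensity.integrable (hg : IsDensity μ g) : Integrable g μ := by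
  refine ⟨hg.measurable.aestronglyMeasurable, ?_⟩
  rw [hasFiniteIntegral_iff_ofReal (Filter.Eventually.of_forall hg.nonneg), hg.lintegral_eq_one]
  exact ENNReal.one_lt_top

lemma IsDensity.integral_eq_one (hg : IsDensity μ g) : ∫ x, g x ∂μ = 1 := by
  rw [integral_eq_lintegral_of_nonneg_ae (Filter.Eventually.of_forall hg.nonneg)
    hg.measurable.aestronglyMeasurable, hg.lintegral_eq_one, ENNReal.toReal_one]

lemma IsDensity.memLp_sqrt (hg : IsDensity μ g) : MemLp (fun x => √(g x)) 2 μ := by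
  rw [memLp_two_iff_integrable_sq hg.measurable.sqrt.aestronglyMeasurable]
  simpa only [Real.sq_sqrt (hg.nonneg _)] using hg.integrable

lemma IsDensity.integrable_sq_sub (hg : IsDensity μ g) (hg' : IsDensity μ g') :
    Integrable (fun x => (√(g x) - √(g' x)) ^ 2) μ :=
  (hg.memLp_sqrt.sub hg'.memLp_sqrt).integrable_sq

lemma hellSq_nonneg (μ : Measure X) (g g' : X → ℝ) : 0 ≤ hellSq μ g g' :=
  mul_nonneg (by norm_num) (integral_nonneg fun _ => sq_nonneg _)

lemma hellSq_comm (μ : Measure X) (g g' : X → ℝ) : hellSq μ g g' = hellSq μ g' g := by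
  simp only [hellSq, sub_sq_comm]

lemma hellSq_le_one (hg : IsDensity μ g) (hg' : IsDensity μ g') : hellSq μ g g' ≤ 1 := by
  have h : ∫ x, (√(g x) - √(g' x)) ^ 2 ∂μ ≤ ∫ x, (g x + g' x) ∂μ := by
    refine integral_mono (hg.integrable_sq_sub hg') (hg.integrable.add hg'.integrable) fun x => ?_
    have h1 := Real.sq_sqrt (hg.nonneg x)
    have h2 := Real.sq_sqrt (hg'.nonneg x)
    have h3 := mul_nonneg (Real.sqrt_nonneg (g x)) (Real.sqrt_nonneg (g' x))
    dsimp only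
    nlinarith
  rw [integral_add hg.integrable hg'.integrable, hg.integral_eq_one, hg'.integral_eq_one] at h
  unfold hellSq
  linarith

lemma norm_toLp_two_sq {u : X → ℝ} (hu : MemLp u 2 μ) : ‖hu.toLp u‖ ^ 2 = ∫ x, u x ^ 2 ∂μ := by
  rw [← real_inner_self_eq_norm_sq, L2.inner_def]
  refine integral_congr_ae ?_
  filter_upwards [hu.coeFn_toLp] with x hx
  rw [hx, real_inner_self_eq_norm_sq, Real.norm_eq_abs, sq_abs]

lemma sqrt_hellSq_eq (hg : IsDensity μ g) (hg' : IsDensity μ g') :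
    √(hellSq μ g g') = √(1 / 2) * dist (hg.memLp_sqrt.toLp _) (hg'.memLp_sqrt.toLp _) := by
  rw [dist_eq_norm, ← MemLp.toLp_sub, hellSq, Real.sqrt_mul (by norm_num)]
  congr 1
  rw [Real.sqrt_eq_iff_eq_sq (integral_nonneg fun _ => sq_nonneg _) (norm_nonneg _),
    norm_toLp_two_sq]
  rfl

lemma sqrt_hellSq_triangle (hg : IsDensity μ g) (hg' : IsDensity μ g') (hg'' : IsDensity μ g'') :
    √(hellSq μ g g'') ≤ √(hellSq μ g g') + √(hellSq μ g' g'') := by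
  rw [sqrt_hellSq_eq hg hg', sqrt_hellSq_eq hg' hg'', sqrt_hellSq_eq hg hg'', ← mul_add]
  exact mul_le_mul_of_nonneg_left (dist_triangle _ _ _) (Real.sqrt_nonneg _)

lemma hellSq_le_two_mul_add (hg : IsDensity μ g) (hg' : IsDensity μ g')
    (hg'' : IsDensity μ g'') : hellSq μ g g'' ≤ 2 * hellSq μ g g' + 2 * hellSq μ g' g'' := by
  have h := sqrt_hellSq_triangle hg hg' hg''
  have h1 := Real.sq_sqrt (hellSq_nonneg μ g g'')
  have h2 := Real.sq_sqrt (hellSq_nonneg μ g g')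
  have h3 := Real.sq_sqrt (hellSq_nonneg μ g' g'')
  have h4 := Real.sqrt_nonneg (hellSq μ g g'')
  nlinarith [sq_nonneg (√(hellSq μ g g') - √(hellSq μ g' g''))]

end Hellinger

/-! ### Mean, second moment and deviations of the test statistic -/

/-- The contribution `(√b - √a) / √(a + b)` of one observation to the test statistic, where `a`
and `b` are the values of the two competing densities at that observation. -/
def testScore (a b : ℝ) : ℝ := (√b - √a) / √(a + b)

lemma abs_testScore_le_one {a b : ℝ} (ha : 0 ≤ a) (hb : 0 ≤ b) : |testScore a b| ≤ 1 := by
  rw [testScore, abs_div, abs_of_nonneg (Real.sqrt_nonneg (a + b))]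
  refine div_le_one_of_le₀ (Real.abs_le_sqrt ?_) (Real.sqrt_nonneg _)
  nlinarith [Real.sq_sqrt ha, Real.sq_sqrt hb,
    mul_nonneg (Real.sqrt_nonneg a) (Real.sqrt_nonneg b)]

lemma testScore_mul_sqrt {a b : ℝ} (ha : 0 ≤ a) (hb : 0 ≤ b) :
    testScore a b * √(a + b) = √b - √a := by
  rcases eq_or_ne (√(a + b)) 0 with h0 | h0
  · have : a + b ≤ 0 := Real.sqrt_eq_zero'.mp h0
    have hA : a = 0 := by linarith
    have hB : b = 0 := by linarith
    simp [hA, hB]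
  · rw [testScore, div_mul_cancel₀ _ h0]

lemma sqrt_add_sqrt_le {a b : ℝ} (ha : 0 ≤ a) (hb : 0 ≤ b) : √a + √b ≤ √2 * √(a + b) := by
  rw [← Real.sqrt_mul (by norm_num)]
  refine Real.le_sqrt_of_sq_le ?_
  nlinarith [sq_nonneg (√a - √b), Real.sq_sqrt ha, Real.sq_sqrt hb]

/-- `testScore a b · (σ² + (a + b) / 2)` is bounded by completing the square
`σ² + (a + b) / 2 = (σ - √((a + b) / 2))² + 2 σ √((a + b) / 2)`, bounding the score by `1` in
front of the square, and using that `√` is concave. -/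
lemma score_mean_le {σ a b : ℝ} (hσ : 0 ≤ σ) (ha : 0 ≤ a) (hb : 0 ≤ b) :
    σ * testScore a b + 1 / 2 * (√(a + b) * (√b - √a)) ≤
      (√2 + 1) * (1 / 2 * (√σ - √a) ^ 2) - (√2 - 1) * (1 / 2 * (√σ - √b) ^ 2)
        + √2 / 2 * (b - a) := by
  have h2 : √2 ^ 2 = 2 := Real.sq_sqrt (by norm_num)
  have h2' := Real.sqrt_nonneg 2
  have hs := Real.sq_sqrt hσ
  have ha' := Real.sq_sqrt ha
  have hb' := Real.sq_sqrt hb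
  have hR := Real.sq_sqrt (add_nonneg ha hb)
  have hle := (abs_le.mp (abs_testScore_le_one ha hb)).2
  have hT := testScore_mul_sqrt ha hb
  have hs0 := Real.sqrt_nonneg σ
  have ha0 := Real.sqrt_nonneg a
  have hb0 := Real.sqrt_nonneg b
  have hR0 := Real.sqrt_nonneg (a + b)
  have hcon := sqrt_add_sqrt_le ha hb
  generalize testScore a b = T at *
  generalize √(a + b) = R at *
  generalize √σ = p at *
  generalize √a = u at *
  generalize √b = w at *
  generalize √2 = r at *
  subst hs ha' hb'
  have key : T * (p - r / 2 * R) ^ 2 ≤ (p - r / 2 * R) ^ 2 :=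
    mul_le_of_le_one_left (sq_nonneg _) hle
  have e1 : T * (p - r / 2 * R) ^ 2 = p ^ 2 * T - r * p * (w - u) + 1 / 2 * (R * (w - u)) := by
    rw [← hT]
    linear_combination (R ^ 2 * T / 4) * h2
  have e2 : (p - r / 2 * R) ^ 2 ≤ p ^ 2 - p * (u + w) + (u ^ 2 + w ^ 2) / 2 := by
    have e3 : (p - r / 2 * R) ^ 2 = p ^ 2 - p * (r * R) + (u ^ 2 + w ^ 2) / 2 := by
      linear_combination (R ^ 2 / 4) * h2 + hR / 2
    rw [e3]
    nlinarith [mul_le_mul_of_nonneg_left hcon hs0]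
  nlinarith

lemma score_sq_le {σ a b : ℝ} (hσ : 0 ≤ σ) (ha : 0 ≤ a) (hb : 0 ≤ b) :
    σ * testScore a b ^ 2 ≤ 3 * (√σ - √a) ^ 2 + 3 * (√σ - √b) ^ 2 := by
  have h2 : √2 ^ 2 = 2 := Real.sq_sqrt (by norm_num)
  have hs := Real.sq_sqrt hσ
  have ha' := Real.sq_sqrt ha
  have hb' := Real.sq_sqrt hb
  have hR := Real.sq_sqrt (add_nonneg ha hb)
  have hle : testScore a b ^ 2 ≤ 1 := (sq_le_one_iff_abs_le_one _).mpr (abs_testScore_le_one ha hb)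
  have hT := testScore_mul_sqrt ha hb
  have hs0 := Real.sqrt_nonneg σ
  have hcon := sqrt_add_sqrt_le ha hb
  generalize testScore a b = T at *
  generalize √(a + b) = R at *
  generalize √σ = p at *
  generalize √a = u at *
  generalize √b = w at *
  generalize √2 = r at *
  subst hs ha' hb'
  have key : T ^ 2 * (p - r / 2 * R) ^ 2 ≤ (p - r / 2 * R) ^ 2 :=
    mul_le_of_le_one_left (sq_nonneg _) hle
  have e3 : (p - r / 2 * R) ^ 2 = p ^ 2 - p * (r * R) + (u ^ 2 + w ^ 2) / 2 := by
    linear_combination (R ^ 2 / 4) * h2 + hR / 2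
  have e2 : (p - r / 2 * R) ^ 2 ≤ p ^ 2 - p * (u + w) + (u ^ 2 + w ^ 2) / 2 := by
    rw [e3]
    nlinarith [mul_le_mul_of_nonneg_left hcon hs0]
  have e4 : p ^ 2 * T ^ 2 ≤ 2 * (T ^ 2 * (p - r / 2 * R) ^ 2) + (w - u) ^ 2 := by
    rw [← hT]
    nlinarith [sq_nonneg (T * (p - r * R)), h2]
  nlinarith [sq_nonneg ((p - u) + (p - w))]

section Deviation

variable {𝕏 : Type*} [MeasurableSpace 𝕏] {μ : Measure 𝕏} {s g g' : 𝕏 → ℝ}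

lemma measurable_testScore (hg : IsDensity μ g) (hg' : IsDensity μ g') :
    Measurable fun x => testScore (g x) (g' x) :=
  (hg'.measurable.sqrt.sub hg.measurable.sqrt).div (hg.measurable.add hg'.measurable).sqrt

lemma integrable_density_mul (hs : IsDensity μ s) {φ : 𝕏 → ℝ} (hφ : Measurable φ) {C : ℝ}
    (hC : ∀ x, |φ x| ≤ C) : Integrable (fun x => s x * φ x) μ :=
  hs.integrable.mul_bdd hφ.aestronglyMeasurable (Filter.Eventually.of_forall hC)

lemma integral_score_le (hs : IsDensity μ s) (hg : IsDensity μ g) (hg' : IsDensity μ g') :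
    ∫ x, s x * testScore (g x) (g' x) ∂μ
        + 1 / 2 * ∫ x, √(g x + g' x) * (√(g' x) - √(g x)) ∂μ
      ≤ (√2 + 1) * hellSq μ s g - (√2 - 1) * hellSq μ s g' := by
  have i1 : Integrable (fun x => s x * testScore (g x) (g' x)) μ :=
    integrable_density_mul hs (measurable_testScore hg hg')
      fun x => abs_testScore_le_one (hg.nonneg x) (hg'.nonneg x)
  have i2 : Integrable (fun x => √(g x + g' x) * (√(g' x) - √(g x))) μ := by
    refine MemLp.integrable_mul (p := 2) (q := 2) ?_ (hg'.memLp_sqrt.sub hg.memLp_sqrt)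
    have hm : Measurable fun x => √(g x + g' x) := (hg.measurable.add hg'.measurable).sqrt
    rw [memLp_two_iff_integrable_sq hm.aestronglyMeasurable]
    simp only [Real.sq_sqrt (add_nonneg (hg.nonneg _) (hg'.nonneg _))]
    exact hg.integrable.add hg'.integrable
  have j1 := ((hs.integrable_sq_sub hg).const_mul (1 / 2)).const_mul (√2 + 1)
  have j2 := ((hs.integrable_sq_sub hg').const_mul (1 / 2)).const_mul (√2 - 1)
  have j3 := (hg'.integrable.sub hg.integrable).const_mul (√2 / 2)
  have := integral_mono (i1.add (i2.const_mul (1 / 2))) ((j1.sub j2).add j3)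
    fun x => score_mean_le (hs.nonneg x) (hg.nonneg x) (hg'.nonneg x)
  rw [integral_add' i1 (i2.const_mul _), integral_const_mul, integral_add' (j1.sub j2) j3,
    integral_sub' j1 j2, integral_const_mul, integral_const_mul, integral_const_mul,
    integral_const_mul, integral_const_mul, integral_sub' hg'.integrable hg.integrable,
    hg.integral_eq_one, hg'.integral_eq_one] at this
  unfold hellSq
  linarith

lemma integral_score_sq_le (hs : IsDensity μ s) (hg : IsDensity μ g) (hg' : IsDensity μ g') :
    ∫ x, s x * testScore (g x) (g' x) ^ 2 ∂μ ≤ 6 * (hellSq μ s g + hellSq μ s g') := by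
  have i1 : Integrable (fun x => s x * testScore (g x) (g' x) ^ 2) μ := by
    refine integrable_density_mul hs ((measurable_testScore hg hg').pow_const 2) (C := 1)
      fun x => ?_
    rw [abs_pow]
    exact pow_le_one₀ (abs_nonneg _) (abs_testScore_le_one (hg.nonneg x) (hg'.nonneg x))
  have j1 := (hs.integrable_sq_sub hg).const_mul 3
  have j2 := (hs.integrable_sq_sub hg').const_mul 3
  have := integral_mono i1 (j1.add j2)
    fun x => score_sq_le (hs.nonneg x) (hg.nonneg x) (hg'.nonneg x)
  rw [integral_add' j1 j2, integral_const_mul, integral_const_mul] at this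
  unfold hellSq
  linarith

variable {Ω : Type*} [MeasurableSpace Ω] {P : Measure Ω}

lemma mgf_score_le (hs : IsDensity μ s) (hg : IsDensity μ g) (hg' : IsDensity μ g')
    {Y : Ω → 𝕏} (hY : Measurable Y)
    (hlaw : P.map Y = μ.withDensity (fun x => ENNReal.ofReal (s x))) {l : ℝ} (hl : 0 ≤ l)
    (hl1 : l ≤ 1) :
    mgf (fun ω => testScore (g (Y ω)) (g' (Y ω))) P l ≤
      Real.exp (l * ∫ x, s x * testScore (g x) (g' x) ∂μ
        + l ^ 2 * (6 * (hellSq μ s g + hellSq μ s g'))) := by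
  have hT := measurable_testScore hg hg'
  have hb : ∀ x, |l * testScore (g x) (g' x)| ≤ 1 := fun x => by
    rw [abs_mul, abs_of_nonneg hl]
    exact mul_le_one₀ hl1 (abs_nonneg _) (abs_testScore_le_one (hg.nonneg x) (hg'.nonneg x))
  have e1 : mgf (fun ω => testScore (g (Y ω)) (g' (Y ω))) P l
      = ∫ x, s x * Real.exp (l * testScore (g x) (g' x)) ∂μ := by
    rw [mgf, ← integral_map (f := fun x => Real.exp (l * testScore (g x) (g' x)))
      hY.aemeasurable (hT.const_mul l).exp.aestronglyMeasurable, hlaw,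
      integral_withDensity_eq_integral_toReal_smul hs.measurable.ennreal_ofReal
        (Filter.Eventually.of_forall fun _ => ENNReal.ofReal_lt_top)]
    simp only [ENNReal.toReal_ofReal (hs.nonneg _), smul_eq_mul]
  have i1 : Integrable (fun x => s x * testScore (g x) (g' x)) μ :=
    integrable_density_mul hs hT
      fun x => abs_testScore_le_one (hg.nonneg x) (hg'.nonneg x)
  have i2 : Integrable (fun x => s x * testScore (g x) (g' x) ^ 2) μ := by
    refine integrable_density_mul hs (hT.pow_const 2) (C := 1) fun x => ?_
    rw [abs_pow]
    exact pow_le_one₀ (abs_nonneg _) (abs_testScore_le_one (hg.nonneg x) (hg'.nonneg x))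
  have i3 : Integrable (fun x => s x * Real.exp (l * testScore (g x) (g' x))) μ := by
    refine integrable_density_mul hs (hT.const_mul l).exp (C := Real.exp 1) fun x => ?_
    rw [abs_of_pos (Real.exp_pos _)]
    exact Real.exp_le_exp.mpr (abs_le.mp (hb x)).2
  have h := integral_mono i3 ((hs.integrable.add (i1.const_mul l)).add (i2.const_mul (l ^ 2)))
    fun x => by
      have := (abs_le.mp (Real.abs_exp_sub_one_sub_id_le (hb x))).2
      have := mul_le_mul_of_nonneg_left this (hs.nonneg x)
      simp only [Pi.add_apply]
      linarith
  rw [integral_add' (hs.integrable.add (i1.const_mul l)) (i2.const_mul (l ^ 2)),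
    integral_add' hs.integrable (i1.const_mul l), integral_const_mul, integral_const_mul,
    hs.integral_eq_one] at h
  rw [e1]
  refine h.trans (le_trans ?_ (Real.add_one_le_exp _))
  have := mul_le_mul_of_nonneg_left (integral_score_sq_le hs hg hg') (sq_nonneg l)
  linarith

/-- Bernstein-type deviation bound for one test, by Chernoff's method with parameter `l ≤ 1`. -/
lemma testStat_deviation [IsProbabilityMeasure P] (hs : IsDensity μ s) (hg : IsDensity μ g) (hg' : IsDensity μ g')
    {n : ℕ} (hn : 1 ≤ n) {X : Fin n → Ω → 𝕏} (hX : ∀ i, Measurable (X i))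
    (hindep : iIndepFun X P)
    (hlaw : ∀ i, P.map (X i) = μ.withDensity (fun x => ENNReal.ofReal (s x)))
    {l : ℝ} (hl : 0 < l) (hl1 : l ≤ 1) (y : ℝ) :
    P {ω | (√2 + 1) * hellSq μ s g - (√2 - 1) * hellSq μ s g'
          + 6 * l * (hellSq μ s g + hellSq μ s g') + y / (n * l)
        ≤ testStat μ (fun i => X i ω) g g'} ≤ ENNReal.ofReal (Real.exp (-y)) := by
  have hn0 : (0 : ℝ) < n := by exact_mod_cast hn
  have hT := measurable_testScore hg hg'
  set φ : 𝕏 → ℝ := fun x => testScore (g x) (g' x) with hφ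
  set e := ∫ x, s x * φ x ∂μ with he
  set b := 1 / 2 * ∫ x, √(g x + g' x) * (√(g' x) - √(g x)) ∂μ with hb
  set v := 6 * (hellSq μ s g + hellSq μ s g') with hv
  set S : Ω → ℝ := ∑ i, (φ ∘ X i) with hS
  have hm : ∀ i, Measurable (φ ∘ X i) := fun i => hT.comp (hX i)
  have hmean : e + b ≤ (√2 + 1) * hellSq μ s g - (√2 - 1) * hellSq μ s g' :=
    integral_score_le hs hg hg'
  have hS' : ∀ ω, S ω = ∑ i, φ (X i ω) := fun ω => Finset.sum_apply ω _ _
  have hSm : Measurable S := by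
    rw [funext hS']
    exact Finset.measurable_sum _ fun i _ => hm i
  have hint : Integrable (fun ω => Real.exp (l * S ω)) P := by
    refine Integrable.of_bound (hSm.const_mul l).exp.aestronglyMeasurable
      (Real.exp (l * n)) (Filter.Eventually.of_forall fun ω => ?_)
    rw [Real.norm_eq_abs, abs_of_pos (Real.exp_pos _)]
    refine Real.exp_le_exp.mpr (mul_le_mul_of_nonneg_left ?_ hl.le)
    rw [hS']
    calc ∑ i, φ (X i ω) ≤ ∑ _i : Fin n, (1 : ℝ) :=
          Finset.sum_le_sum fun i _ =>
            (abs_le.mp (abs_testScore_le_one (hg.nonneg (X i ω)) (hg'.nonneg (X i ω)))).2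
      _ = n := by simp
  have hmgf : mgf S P l ≤ Real.exp (n * (l * e + l ^ 2 * v)) := by
    rw [hS, (hindep.comp (fun _ => φ) fun _ => hT).mgf_sum hm]
    calc ∏ i, mgf (φ ∘ X i) P l ≤ ∏ _i : Fin n, Real.exp (l * e + l ^ 2 * v) :=
          Finset.prod_le_prod (fun i _ => mgf_nonneg) fun i _ =>
            mgf_score_le hs hg hg' (hX i) (hlaw i) hl.le hl1
      _ = Real.exp (n * (l * e + l ^ 2 * v)) := by
          rw [Finset.prod_const, ← Real.exp_nat_mul, Finset.card_univ, Fintype.card_fin]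
  have hch := measure_ge_le_exp_mul_mgf (n * e + n * l * v + y / l) hl.le hint
  have hsub : {ω | (√2 + 1) * hellSq μ s g - (√2 - 1) * hellSq μ s g'
          + 6 * l * (hellSq μ s g + hellSq μ s g') + y / (n * l)
        ≤ testStat μ (fun i => X i ω) g g'} ⊆ {ω | n * e + n * l * v + y / l ≤ S ω} := by
    intro ω hω
    rw [Set.mem_ofPred_eq] at hω ⊢
    have e1 : testStat μ (fun i => X i ω) g g' = 1 / n * S ω + b := by
      rw [hS']; rfl
    rw [e1] at hω
    have e2 : e + l * v + y / (n * l) ≤ 1 / n * S ω := by rw [hv]; linarith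
    calc n * e + n * l * v + y / l = n * (e + l * v + y / (n * l)) := by field_simp
      _ ≤ n * (1 / n * S ω) := mul_le_mul_of_nonneg_left e2 hn0.le
      _ = S ω := by field_simp
  refine (measure_mono hsub).trans ?_
  rw [← ofReal_measureReal]
  refine ENNReal.ofReal_le_ofReal (hch.trans ?_)
  refine (mul_le_mul_of_nonneg_left hmgf (Real.exp_pos _).le).trans (le_of_eq ?_)
  rw [← Real.exp_add]
  congr 1
  field_simp
  ring

end Deviation

/-! ### Sums of `exp (-b |k|^α)` over integers -/

lemma exp_neg_le_rpow {p u : ℝ} (hp : 0 < p) (hu : 0 < u) :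
    Real.exp (-u) ≤ (2 * p / u) ^ (2 * p) := by
  have h2p : 0 < 2 * p := by linarith
  rw [← Real.log_le_log_iff (Real.exp_pos _) (by positivity), Real.log_exp,
    Real.log_rpow (by positivity)]
  have h := Real.log_le_self (show 0 ≤ u / (2 * p) by positivity)
  rw [← inv_div, Real.log_inv]
  have : u = 2 * p * (u / (2 * p)) := by field_simp
  nlinarith

lemma exp_neg_mul_rpow_le {α b : ℝ} (hα : 0 < α) (hb : 0 < b) (k : ℕ) :
    Real.exp (-(b * ((k : ℝ) + 1) ^ α)) ≤
      4 * ((2 / (α * b)) ^ (1 / α)) ^ 2 *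
        (1 / ((2 / (α * b)) ^ (1 / α) + k) - 1 / ((2 / (α * b)) ^ (1 / α) + (k + 1 : ℕ))) := by
  set A := (2 / (α * b)) ^ (1 / α) with hA
  have hA0 : 0 < A := by positivity
  have hk : (0 : ℝ) ≤ k := Nat.cast_nonneg k
  have hK : (0 : ℝ) < (k : ℝ) + 1 := by positivity
  have h1 : Real.exp (-(b * ((k : ℝ) + 1) ^ α)) ≤ 1 := Real.exp_le_one_iff.mpr (by
    have : 0 < b * ((k : ℝ) + 1) ^ α := by positivity
    linarith)
  have h2 : Real.exp (-(b * ((k : ℝ) + 1) ^ α)) * ((k : ℝ) + 1) ^ 2 ≤ A ^ 2 := by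
    rw [← le_div_iff₀ (by positivity)]
    refine (exp_neg_le_rpow (p := 1 / α) (by positivity) (by positivity)).trans (le_of_eq ?_)
    have e1 : 2 * (1 / α) / (b * ((k : ℝ) + 1) ^ α) = 2 / (α * b) / ((k : ℝ) + 1) ^ α := by
      field_simp
    have e2 : (((k : ℝ) + 1) ^ α) ^ (1 / α) = (k : ℝ) + 1 := by
      rw [← Real.rpow_mul hK.le, mul_one_div_cancel hα.ne', Real.rpow_one]
    rw [e1, mul_comm 2 (1 / α), Real.rpow_mul (by positivity),
      Real.div_rpow (by positivity) (by positivity), e2, ← hA, Real.rpow_two, div_pow]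
  have h3 : Real.exp (-(b * ((k : ℝ) + 1) ^ α)) * (A + (k + 1)) ^ 2 ≤ 4 * A ^ 2 := by
    have h0 := (Real.exp_pos (-(b * ((k : ℝ) + 1) ^ α))).le
    generalize Real.exp (-(b * ((k : ℝ) + 1) ^ α)) = E at *
    rcases le_total ((k : ℝ) + 1) A with h | h
    · calc E * (A + (k + 1)) ^ 2 ≤ 1 * (A + (k + 1)) ^ 2 := by gcongr
        _ ≤ 1 * (A + A) ^ 2 := by gcongr
        _ = 4 * A ^ 2 := by ring
    · calc E * (A + (k + 1)) ^ 2 ≤ E * ((k + 1) + (k + 1)) ^ 2 := by gcongr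
        _ = 4 * (E * ((k : ℝ) + 1) ^ 2) := by ring
        _ ≤ 4 * A ^ 2 := by linarith
  have h4 : 1 / (A + k) - 1 / (A + (k + 1 : ℕ)) = 1 / ((A + k) * (A + (k + 1))) := by
    push_cast
    field_simp
    ring
  rw [h4, mul_one_div, le_div_iff₀ (by positivity)]
  refine le_trans ?_ h3
  have := Real.exp_pos (-(b * ((k : ℝ) + 1) ^ α))
  gcongr
  nlinarith

/-- Elementary substitute for `∑ exp (-b k^α) ≤ b^(-1/α) Γ(1 + 1/α)`: since
`exp (-b k^α) ≤ min 1 (A² / k²)`, the sum is dominated by a telescoping one. -/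
lemma sum_exp_neg_mul_rpow_le {α b : ℝ} (hα : 0 < α) (hb : 0 < b) (n : ℕ) :
    ∑ k ∈ Finset.range n, Real.exp (-(b * ((k : ℝ) + 1) ^ α)) ≤
      4 * (2 / (α * b)) ^ (1 / α) := by
  refine (Finset.sum_le_sum fun k _ => exp_neg_mul_rpow_le hα hb k).trans ?_
  set A := (2 / (α * b)) ^ (1 / α) with hA
  have hA0 : 0 < A := by positivity
  rw [← Finset.mul_sum, Finset.sum_range_sub' (fun k : ℕ => 1 / (A + (k : ℝ)))]
  have : 0 ≤ 1 / (A + (n : ℝ)) := by positivity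
  calc 4 * A ^ 2 * (1 / (A + (0 : ℕ)) - 1 / (A + (n : ℝ)))
      ≤ 4 * A ^ 2 * (1 / (A + (0 : ℕ))) := by gcongr; linarith
    _ = 4 * A := by
      rw [Nat.cast_zero, add_zero]
      field_simp

lemma sum_exp_neg_mul_abs_sub_rpow_le {α b : ℝ} (hα : 0 < α) (hb : 0 < b) (k₀ m : ℕ) :
    ∑ k ∈ Finset.range m, Real.exp (-(b * |(k : ℝ) - k₀| ^ α)) ≤
      1 + 8 * (2 / (α * b)) ^ (1 / α) := by
  have hsub : Finset.range m ⊆ Finset.range (k₀ + (m + 1)) := by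
    intro k hk
    rw [Finset.mem_range] at *
    omega
  refine (Finset.sum_le_sum_of_subset_of_nonneg hsub
    fun _ _ _ => (Real.exp_pos _).le).trans ?_
  rw [Finset.sum_range_add, Finset.sum_range_succ', ← Finset.sum_range_reflect]
  have e1 : ∑ j ∈ Finset.range k₀, Real.exp (-(b * |((k₀ - 1 - j : ℕ) : ℝ) - k₀| ^ α))
      = ∑ j ∈ Finset.range k₀, Real.exp (-(b * ((j : ℝ) + 1) ^ α)) := by
    refine Finset.sum_congr rfl fun j hj => ?_
    have hj' : k₀ - 1 - j + (j + 1) = k₀ := by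
      have := Finset.mem_range.mp hj
      omega
    have hj2 : ((k₀ - 1 - j : ℕ) : ℝ) + ((j : ℝ) + 1) = k₀ := by exact_mod_cast hj'
    rw [show ((k₀ - 1 - j : ℕ) : ℝ) - k₀ = -((j : ℝ) + 1) by linarith, abs_neg,
      abs_of_pos (by positivity)]
  have e2 : ∑ j ∈ Finset.range m, Real.exp (-(b * |((k₀ + (j + 1) : ℕ) : ℝ) - k₀| ^ α))
      = ∑ j ∈ Finset.range m, Real.exp (-(b * ((j : ℝ) + 1) ^ α)) := by
    refine Finset.sum_congr rfl fun j _ => ?_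
    push_cast
    rw [add_sub_cancel_left, abs_of_pos (by positivity)]
  rw [e1, e2]
  have h1 := sum_exp_neg_mul_rpow_le hα hb k₀
  have h2 := sum_exp_neg_mul_rpow_le hα hb m
  simp only [add_zero, sub_self, abs_zero, Real.zero_rpow hα.ne', mul_zero, neg_zero,
    Real.exp_zero]
  linarith

lemma sum_piFinset_exp_neg_le {d : ℕ} {α b : Fin d → ℝ} (hα : ∀ j, 0 < α j) (hb : ∀ j, 0 < b j)
    (k₀ K : Fin d → ℕ) :
    ∑ k ∈ Fintype.piFinset fun j => Finset.range (K j),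
        Real.exp (-∑ j, b j * |(k j : ℝ) - k₀ j| ^ α j)
      ≤ ∏ j, (1 + 8 * (2 / (α j * b j)) ^ (1 / α j)) := by
  simp only [← Finset.sum_neg_distrib, Real.exp_sum]
  rw [← Finset.prod_univ_sum (fun j => Finset.range (K j))
    (fun j k => Real.exp (-(b j * |(k : ℝ) - k₀ j| ^ α j)))]
  exact Finset.prod_le_prod (fun j _ => Finset.sum_nonneg fun _ _ => (Real.exp_pos _).le)
    fun j _ => sum_exp_neg_mul_abs_sub_rpow_le (hα j) (hb j) (k₀ j) (K j)

/-! ### The grid -/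

section Grid

variable {d : ℕ}

/-- The point of index `k` of the grid of origin `m` and mesh `ε`. -/
def gridPoint (m ε : Fin d → ℝ) (k : Fin d → ℕ) : Fin d → ℝ := fun j => m j + k j * ε j

/-- The indices of the grid points of the rectangle `∏ⱼ [mⱼ, Mⱼ]`, for the grid of origin `m` and
mesh `ε` (when `m ≤ M` and `ε` is positive). -/
def gridIndex (m M ε : Fin d → ℝ) : Finset (Fin d → ℕ) :=
  Fintype.piFinset fun j => Finset.range (⌊(M j - m j) / ε j⌋₊ + 1)

variable {m M ε θ : Fin d → ℝ}

lemma gridPoint_mem_Icc (hmM : m ≤ M) (hε : ∀ j, 0 < ε j) {k : Fin d → ℕ}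
    (hk : k ∈ gridIndex m M ε) : gridPoint m ε k ∈ Set.Icc m M := by
  refine ⟨fun j => ?_, fun j => ?_⟩
  · have := mul_nonneg (Nat.cast_nonneg (α := ℝ) (k j)) (hε j).le
    simp only [gridPoint]
    linarith
  · have h1 : k j ≤ ⌊(M j - m j) / ε j⌋₊ :=
      Nat.lt_succ_iff.mp (Finset.mem_range.mp (Fintype.mem_piFinset.mp hk j))
    have h2 : (k j : ℝ) ≤ (M j - m j) / ε j :=
      (Nat.le_floor_iff (div_nonneg (sub_nonneg.mpr (hmM j)) (hε j).le)).mp h1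
    rw [le_div_iff₀ (hε j)] at h2
    simp only [gridPoint]
    linarith

lemma exists_gridProj_eq (hε : ∀ j, 0 < ε j) (hθ : θ ∈ Set.Icc m M) :
    ∃ k ∈ gridIndex m M ε, gridProj m ε θ = gridPoint m ε k := by
  refine ⟨fun j => ⌊(θ j - m j) / ε j⌋₊, ?_, ?_⟩
  · refine Fintype.mem_piFinset.mpr fun j => Finset.mem_range.mpr (Nat.lt_succ_of_le ?_)
    exact Nat.floor_le_floor (div_le_div_of_nonneg_right (sub_le_sub_right (hθ.2 j) _) (hε j).le)
  · funext j
    simp only [gridProj, gridPoint]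
    rw [natCast_floor_eq_intCast_floor (div_nonneg (sub_nonneg.mpr (hθ.1 j)) (hε j).le)]

lemma abs_sub_gridProj_le (hε : ∀ j, 0 < ε j) (j : Fin d) :
    |θ j - gridProj m ε θ j| ≤ ε j := by
  have h1 := Int.floor_le ((θ j - m j) / ε j)
  have h2 := Int.lt_floor_add_one ((θ j - m j) / ε j)
  rw [le_div_iff₀ (hε j)] at h1
  rw [div_lt_iff₀ (hε j)] at h2
  simp only [gridProj]
  rw [abs_le]
  constructor <;> linarith [hε j]

end Grid

/-! ### Discretization of the model -/

lemma le_dimTerm {d : ℕ} (c : ℝ) (t α Rlow Rup : Fin d → ℝ) : (d : ℝ) ≤ dimTerm c t α Rlow Rup :=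
  le_max_left _ _

section Model

variable {X : Type*} [MeasurableSpace X] {μ : Measure X} {d : ℕ} {f : (Fin d → ℝ) → X → ℝ}
  {m M α Rlow Rup t : Fin d → ℝ}

lemma IsModel.mesh_pos (hf : IsModel μ f m M α Rlow Rup) {n : ℕ} (hn : 1 ≤ n)
    (ht : ∀ j, 0 < t j) (j : Fin d) : 0 < mesh n t α Rup j := by
  have hn0 : (0 : ℝ) < n := by exact_mod_cast hn
  have := hf.Rup_pos j
  have := ht j
  unfold mesh
  positivity

lemma IsModel.mesh_rpow (hf : IsModel μ f m M α Rlow Rup) {n : ℕ}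
    (ht : ∀ j, 0 < t j) (j : Fin d) :
    mesh n t α Rup j ^ α j = t j ^ α j / (Rup j * n) := by
  have hR := (mul_nonneg (hf.Rup_pos j).le (Nat.cast_nonneg (α := ℝ) n))
  rw [mesh, Real.mul_rpow (ht j).le (Real.rpow_nonneg hR _), ← Real.rpow_mul hR, neg_mul,
    one_div_mul_cancel (hf.alpha_pos j).ne', Real.rpow_neg_one, div_eq_mul_inv]

lemma IsModel.hellSq_gridProj_le (hf : IsModel μ f m M α Rlow Rup) {n : ℕ} (hn : 1 ≤ n)
    (hd : 1 ≤ d) (ht : ∀ j, 0 < t j ∧ t j ≤ (d : ℝ) ^ (1 / α j)) {θ : Fin d → ℝ}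
    (hθ : θ ∈ Set.Icc m M) :
    hellSq μ (f θ) (f (gridProj m (mesh n t α Rup) θ)) ≤ d / n := by
  have hn0 : (0 : ℝ) < n := by exact_mod_cast hn
  have hε := hf.mesh_pos hn fun j => (ht j).1
  obtain ⟨k, hk, hkθ⟩ := exists_gridProj_eq hε hθ
  have hmem : gridProj m (mesh n t α Rup) θ ∈ Set.Icc m M :=
    hkθ ▸ gridPoint_mem_Icc (hθ.1.trans hθ.2) hε hk
  have : Nonempty (Fin d) := ⟨⟨0, hd⟩⟩
  refine (hf.upper θ hθ _ hmem).trans (ciSup_le fun j => ?_)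
  have hα := hf.alpha_pos j
  have hR := hf.Rup_pos j
  calc Rup j * |θ j - gridProj m (mesh n t α Rup) θ j| ^ α j
      ≤ Rup j * mesh n t α Rup j ^ α j := by
        gcongr
        exact abs_sub_gridProj_le hε j
    _ = t j ^ α j / n := by
        rw [hf.mesh_rpow fun j => (ht j).1]
        field_simp
    _ ≤ ((d : ℝ) ^ (1 / α j)) ^ α j / n := by
        gcongr
        · exact (ht j).1.le
        · exact (ht j).2
    _ = d / n := by
        rw [← Real.rpow_mul (Nat.cast_nonneg d), one_div_mul_cancel hα.ne', Real.rpow_one]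

/-- The number of grid points near a given one, in exponentially weighted form. The supremum in
the lower bound on `h²` is bounded below by the average with weights proportional to `1 / αⱼ`, which
makes the sum a product; these weights are the ones that produce the harmonic mean of `α`. -/
lemma IsModel.sum_exp_neg_hellSq_le (hf : IsModel μ f m M α Rlow Rup) {n : ℕ} (hn : 1 ≤ n)
    (hd : 1 ≤ d) (ht : ∀ j, 0 < t j) {a : ℝ} (ha : 0 < a) (hmM : m ≤ M) {k₀ : Fin d → ℕ}
    (hk₀ : k₀ ∈ gridIndex m M (mesh n t α Rup)) :
    ∑ k ∈ gridIndex m M (mesh n t α Rup),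
        Real.exp (-(n * (a / 2) * hellSq μ (f (gridPoint m (mesh n t α Rup) k))
          (f (gridPoint m (mesh n t α Rup) k₀))))
      ≤ Real.exp (4 * dimTerm (4 / a) t α Rlow Rup) := by
  have hn0 : (0 : ℝ) < n := by exact_mod_cast hn
  have hd0 : (0 : ℝ) < d := by exact_mod_cast hd
  have hε := hf.mesh_pos hn ht
  have hne : Nonempty (Fin d) := ⟨⟨0, hd⟩⟩
  set W := ∑ j, 1 / α j with hW
  have hWpos : 0 < W :=
    Finset.sum_pos (fun j _ => one_div_pos.mpr (hf.alpha_pos j)) Finset.univ_nonempty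
  have hWd : d / harmonicMean α = W := by
    rw [harmonicMean, div_inv_eq_mul, ← mul_assoc, mul_one_div_cancel hd0.ne', one_mul]
  set b : Fin d → ℝ := fun j => a / 2 * (1 / α j / W) * (Rlow j * t j ^ α j / Rup j) with hb
  have hbpos : ∀ j, 0 < b j := fun j => by
    have := hf.alpha_pos j
    have := hf.Rup_pos j
    have := hf.Rlow_pos j
    have := ht j
    simp only [hb]
    positivity
  have hexp : ∀ k ∈ gridIndex m M (mesh n t α Rup),
      ∑ j, b j * |(k j : ℝ) - k₀ j| ^ α j ≤
        n * (a / 2) * hellSq μ (f (gridPoint m (mesh n t α Rup) k))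
          (f (gridPoint m (mesh n t α Rup) k₀)) := by
    intro k hk
    set H := hellSq μ (f (gridPoint m (mesh n t α Rup) k))
          (f (gridPoint m (mesh n t α Rup) k₀)) with hH
    have hlow : ∀ j, Rlow j * (mesh n t α Rup j * |(k j : ℝ) - k₀ j|) ^ α j ≤ H := by
      intro j
      have h1 := hf.lower _ (gridPoint_mem_Icc hmM hε hk) _ (gridPoint_mem_Icc hmM hε hk₀)
      refine le_trans (le_of_eq ?_) ((le_ciSup (Set.finite_range _).bddAbove j).trans h1)
      rw [← abs_of_pos (hε j), ← abs_mul]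
      congr 3
      simp only [gridPoint]
      ring
    calc ∑ j, b j * |(k j : ℝ) - k₀ j| ^ α j
        ≤ ∑ j, n * (a / 2) * (1 / α j / W * H) := by
          refine Finset.sum_le_sum fun j _ => ?_
          have hα := hf.alpha_pos j
          have hR := hf.Rup_pos j
          have h1 := hlow j
          rw [Real.mul_rpow (hε j).le (abs_nonneg _), hf.mesh_rpow ht] at h1
          calc b j * |(k j : ℝ) - k₀ j| ^ α j
              = n * (a / 2) * (1 / α j / W * (Rlow j * (t j ^ α j / (Rup j * n)
                  * |(k j : ℝ) - k₀ j| ^ α j))) := by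
                simp only [hb]
                field_simp
            _ ≤ _ := by gcongr
      _ = n * (a / 2) * H := by
          rw [← Finset.mul_sum, ← Finset.sum_mul, ← Finset.sum_div, ← hW, div_self hWpos.ne',
            one_mul]
  refine (Finset.sum_le_sum fun k hk => Real.exp_le_exp.mpr (neg_le_neg (hexp k hk))).trans ?_
  refine (sum_piFinset_exp_neg_le hf.alpha_pos hbpos k₀ _).trans ?_
  set A : Fin d → ℝ := fun j =>
    (t j)⁻¹ * ((d / harmonicMean α) * (4 / a * Rup j / Rlow j)) ^ (1 / α j) with hA
  have hAb : ∀ j, (2 / (α j * b j)) ^ (1 / α j) = A j := by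
    intro j
    have hα := hf.alpha_pos j
    have hR := hf.Rup_pos j
    have hL := hf.Rlow_pos j
    have htj := ht j
    have e1 : 2 / (α j * b j) = (t j ^ α j)⁻¹ * (W * (4 / a * Rup j / Rlow j)) := by
      simp only [hb]
      field_simp
      norm_num
    rw [e1, Real.mul_rpow (by positivity) (by positivity), Real.inv_rpow (by positivity),
      ← Real.rpow_mul htj.le, mul_one_div_cancel hα.ne', Real.rpow_one, ← hWd]
  have hA0 : ∀ j, 0 ≤ A j := fun j => by
    rw [← hAb]
    have := hf.alpha_pos j
    have := hbpos j
    positivity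
  have h8 : (8 : ℝ) ≤ Real.exp 3 := by
    have h := Real.exp_one_gt_d9
    calc (8 : ℝ) = 2 ^ 3 := by norm_num
      _ ≤ Real.exp 1 ^ 3 := by gcongr; linarith
      _ = Real.exp 3 := by rw [← Real.exp_nat_mul]; norm_num
  calc ∏ j, (1 + 8 * (2 / (α j * b j)) ^ (1 / α j))
      ≤ ∏ j, Real.exp (3 + Real.log (1 + A j)) := by
        refine Finset.prod_le_prod (fun j _ => ?_) fun j _ => ?_
        · rw [hAb]; linarith [hA0 j]
        · have := hA0 j
          rw [hAb, Real.exp_add, Real.exp_log (by linarith)]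
          nlinarith
    _ = Real.exp (3 * d + ∑ j, Real.log (1 + A j)) := by
        rw [← Real.exp_sum, Finset.sum_add_distrib]
        simp [mul_comm]
    _ ≤ _ := by
        refine Real.exp_le_exp.mpr ?_
        have h1 := le_dimTerm (4 / a) t α Rlow Rup
        have h2 : ∑ j, Real.log (1 + A j) ≤ dimTerm (4 / a) t α Rlow Rup := le_max_right _ _
        linarith

end Model

/-! ### Uniform control of the tests over the grid -/

section Union

variable {𝕏 : Type*} [MeasurableSpace 𝕏] {μ : Measure 𝕏} {d : ℕ} {f : (Fin d → ℝ) → 𝕏 → ℝ}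
  {m M α Rlow Rup t : Fin d → ℝ} {s : 𝕏 → ℝ}

/-- `sum_exp_neg_hellSq_le` with distances taken from the sampling density `s` instead of
from a grid point. -/
lemma IsModel.sum_exp_neg_hellSq_sample_le (hf : IsModel μ f m M α Rlow Rup)
    (hs : IsDensity μ s) {n : ℕ} (hn : 1 ≤ n)
    (hd : 1 ≤ d) (ht : ∀ j, 0 < t j) {a : ℝ} (ha : 0 < a) (hmM : m ≤ M) {k₀ : Fin d → ℕ}
    (hk₀ : k₀ ∈ gridIndex m M (mesh n t α Rup)) :
    ∑ k ∈ gridIndex m M (mesh n t α Rup),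
        Real.exp (-(n * a * hellSq μ s (f (gridPoint m (mesh n t α Rup) k))))
      ≤ Real.exp (n * a * hellSq μ s (f (gridPoint m (mesh n t α Rup) k₀))
          + 4 * dimTerm (4 / a) t α Rlow Rup) := by
  have hε := hf.mesh_pos hn ht
  have hden : ∀ k ∈ gridIndex m M (mesh n t α Rup),
      IsDensity μ (f (gridPoint m (mesh n t α Rup) k)) :=
    fun k hk => hf.isDensity _ (gridPoint_mem_Icc hmM hε hk)
  rw [Real.exp_add]
  refine le_trans ?_ (mul_le_mul_of_nonneg_left
    (hf.sum_exp_neg_hellSq_le hn hd ht ha hmM hk₀) (Real.exp_pos _).le)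
  rw [Finset.mul_sum]
  refine Finset.sum_le_sum fun k hk => ?_
  rw [← Real.exp_add]
  refine Real.exp_le_exp.mpr ?_
  have h := hellSq_le_two_mul_add (hden k hk) hs (hden k₀ hk₀)
  rw [hellSq_comm μ _ s] at h
  have h0 : 0 ≤ (n : ℝ) * (a / 2) := by positivity
  nlinarith [mul_le_mul_of_nonneg_left h h0]

variable {Ω : Type*} [MeasurableSpace Ω] {P : Measure Ω} [IsProbabilityMeasure P]

/-- Outside an event of probability at most `exp (-n ξ)`, all tests between grid points are close to
their means. The level of the deviation bound grows with the distances of the tested densities to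
`s`, so that the union bound involves the local size of the grid only, not that of the rectangle. -/
lemma IsModel.measure_exists_testStat_ge_le (hf : IsModel μ f m M α Rlow Rup)
    (hs : IsDensity μ s) {n : ℕ} (hn : 1 ≤ n) {X : Fin n → Ω → 𝕏} (hX : ∀ i, Measurable (X i))
    (hindep : iIndepFun X P)
    (hlaw : ∀ i, P.map (X i) = μ.withDensity (fun x => ENNReal.ofReal (s x)))
    (hd : 1 ≤ d) (ht : ∀ j, 0 < t j) {a l : ℝ} (ha : 0 < a) (hl : 0 < l) (hl1 : l ≤ 1)
    (hmM : m ≤ M) {k₀ : Fin d → ℕ} (hk₀ : k₀ ∈ gridIndex m M (mesh n t α Rup)) (ξ : ℝ)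
    {H : (Fin d → ℕ) → ℝ} (hH : ∀ k, H k = hellSq μ s (f (gridPoint m (mesh n t α Rup) k))) :
    P {ω | ∃ k ∈ gridIndex m M (mesh n t α Rup), ∃ k' ∈ gridIndex m M (mesh n t α Rup),
        (√2 + 1) * H k - (√2 - 1) * H k' + 6 * l * (H k + H k')
          + (n * ξ + n * a * (H k + H k')
              + 2 * (n * a * H k₀ + 4 * dimTerm (4 / a) t α Rlow Rup)) / (n * l)
        ≤ testStat μ (fun i => X i ω) (f (gridPoint m (mesh n t α Rup) k))
            (f (gridPoint m (mesh n t α Rup) k'))}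
      ≤ ENNReal.ofReal (Real.exp (-(n * ξ))) := by
  set G := gridIndex m M (mesh n t α Rup) with hG
  set E := n * a * H k₀ + 4 * dimTerm (4 / a) t α Rlow Rup with hE
  have hden : ∀ k ∈ G, IsDensity μ (f (gridPoint m (mesh n t α Rup) k)) :=
    fun k hk => hf.isDensity _ (gridPoint_mem_Icc hmM (hf.mesh_pos hn ht) hk)
  have hsum : ∑ k ∈ G, Real.exp (-(n * a * H k)) ≤ Real.exp E := by
    simp only [hE, hH]
    exact hf.sum_exp_neg_hellSq_sample_le hs hn hd ht ha hmM hk₀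
  have hsum0 : 0 ≤ ∑ k ∈ G, Real.exp (-(n * a * H k)) :=
    Finset.sum_nonneg fun _ _ => (Real.exp_pos _).le
  have hpair : ∀ p ∈ G ×ˢ G, P {ω | (√2 + 1) * H p.1 - (√2 - 1) * H p.2 + 6 * l * (H p.1 + H p.2)
          + (n * ξ + n * a * (H p.1 + H p.2) + 2 * E) / (n * l)
        ≤ testStat μ (fun i => X i ω) (f (gridPoint m (mesh n t α Rup) p.1))
            (f (gridPoint m (mesh n t α Rup) p.2))}
      ≤ ENNReal.ofReal (Real.exp (-(n * ξ + n * a * (H p.1 + H p.2) + 2 * E))) := by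
    intro p hp
    have hp' := Finset.mem_product.mp hp
    simp only [hH p.1, hH p.2]
    exact testStat_deviation hs (hden _ hp'.1) (hden _ hp'.2) hn hX hindep hlaw hl hl1 _
  refine le_trans (measure_mono ?_) ((measure_biUnion_finset_le (G ×ˢ G) _).trans
    ((Finset.sum_le_sum hpair).trans ?_))
  · rintro ω ⟨k, hk, k', hk', h⟩
    exact Set.mem_biUnion (Finset.mk_mem_product hk hk') h
  · rw [← ENNReal.ofReal_sum_of_nonneg fun _ _ => (Real.exp_pos _).le]
    refine ENNReal.ofReal_le_ofReal ?_
    calc ∑ p ∈ G ×ˢ G, Real.exp (-(n * ξ + n * a * (H p.1 + H p.2) + 2 * E))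
        = Real.exp (-(n * ξ)) * Real.exp (-(2 * E))
            * ((∑ k ∈ G, Real.exp (-(n * a * H k))) * ∑ k ∈ G, Real.exp (-(n * a * H k))) := by
          rw [Finset.sum_mul_sum, ← Finset.sum_product', Finset.mul_sum]
          refine Finset.sum_congr rfl fun p _ => ?_
          rw [← Real.exp_add, ← Real.exp_add, ← Real.exp_add]
          congr 1
          ring
      _ ≤ Real.exp (-(n * ξ)) * Real.exp (-(2 * E)) * (Real.exp E * Real.exp E) := by gcongr
      _ = Real.exp (-(n * ξ)) := by
          rw [← Real.exp_add, ← Real.exp_add, ← Real.exp_add]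
          congr 1
          ring

end Union

/-! ### Consequences of a removal -/

lemma testStat_swap {X : Type*} [MeasurableSpace X] (μ : Measure X) {n : ℕ} (x : Fin n → X)
    (g g' : X → ℝ) : testStat μ x g' g = -testStat μ x g g' := by
  have h1 : ∀ a b : ℝ, (√a - √b) / √(b + a) = -((√b - √a) / √(a + b)) := fun a b => by
    rw [← neg_div, neg_sub, add_comm]
  have h2 : ∀ a b : ℝ, √(b + a) * (√a - √b) = -(√(a + b) * (√b - √a)) := fun a b => by
    rw [add_comm]; ring
  unfold testStat
  simp_rw [h1 (g _) (g' _), h2 (g _) (g' _)]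
  rw [Finset.sum_neg_distrib, integral_neg]
  ring

lemma mem_removable {X : Type*} [MeasurableSpace X] {μ : Measure X} {d : ℕ}
    {f : (Fin d → ℝ) → X → ℝ} {κ T : ℝ} {A : Set (Fin d → ℝ)} {θ θ' θ₀ : Fin d → ℝ}
    (h : θ₀ ∈ removable μ f κ A T θ θ') :
    (0 ≤ T ∧ hellSq μ (f θ₀) (f θ) ≤ κ * hellSq μ (f θ) (f θ')) ∨
      (T ≤ 0 ∧ hellSq μ (f θ₀) (f θ') ≤ κ * hellSq μ (f θ) (f θ')) := by
  unfold removable at h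
  split_ifs at h with h1 h2
  · exact Or.inl ⟨h1.le, h.2⟩
  · exact Or.inr ⟨h2.le, h.2⟩
  · rcases h with h | h
    · exact Or.inl ⟨not_lt.mp h2, h.2⟩
    · exact Or.inr ⟨not_lt.mp h1, h.2⟩

section Geometry

variable {X : Type*} [MeasurableSpace X] {μ : Measure X}

/-- If the test prefers `g'` to `g`, in the sense that `h²(s, g') ≤ q² h²(s, g) + K Z` where `g`, `g'`
are discretizations of `u`, `u'`, and if a good approximation `u₀` of `s` is close to `u` relative to
the distance between `u` and `u'`, then `u` and `u'` are close. -/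
lemma hellSq_le_of_close_to_loser {s u₀ u u' g g' : X → ℝ} (hs : IsDensity μ s)
    (hu₀ : IsDensity μ u₀) (hu : IsDensity μ u) (hu' : IsDensity μ u') (hg : IsDensity μ g)
    (hg' : IsDensity μ g') {κ q K Z : ℝ} (hκ : 0 ≤ κ) (hq : 0 ≤ q) (hK : 0 ≤ K) (hZ : 0 ≤ Z)
    (hκq : √κ * (1 + q) < 1) (h₀ : hellSq μ s u₀ ≤ Z) (hgu : hellSq μ u g ≤ Z)
    (hgu' : hellSq μ u' g' ≤ Z) (htest : hellSq μ s g' ≤ q ^ 2 * hellSq μ s g + K * Z)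
    (hclose : hellSq μ u₀ u ≤ κ * hellSq μ u u') :
    hellSq μ u u' ≤ ((2 * (1 + q) + √K) / (1 - √κ * (1 + q))) ^ 2 * Z := by
  have t1 := sqrt_hellSq_triangle hu hs hu'
  have t2 := sqrt_hellSq_triangle hs hg' hu'
  have t3 := sqrt_hellSq_triangle hs hu hg
  have t4 := sqrt_hellSq_triangle hs hu₀ hu
  rw [hellSq_comm μ u s] at t1
  rw [hellSq_comm μ g' u'] at t2
  have s1 : √(hellSq μ s g') ≤ q * √(hellSq μ s g) + √K * √Z := by
    refine Real.sqrt_le_iff.mpr ⟨by positivity, htest.trans ?_⟩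
    have e1 := Real.sq_sqrt (hellSq_nonneg μ s g)
    have e2 := Real.sq_sqrt hK
    have e3 := Real.sq_sqrt hZ
    have e4 : 0 ≤ q * √(hellSq μ s g) * (√K * √Z) := by positivity
    calc q ^ 2 * hellSq μ s g + K * Z
        = q ^ 2 * √(hellSq μ s g) ^ 2 + √K ^ 2 * √Z ^ 2 := by rw [e1, e2, e3]
      _ ≤ _ := by linarith
  have s2 : √(hellSq μ u₀ u) ≤ √κ * √(hellSq μ u u') := by
    rw [← Real.sqrt_mul hκ]
    exact Real.sqrt_le_sqrt hclose
  have s3 := Real.sqrt_le_sqrt h₀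
  have s4 := Real.sqrt_le_sqrt hgu
  have s5 := Real.sqrt_le_sqrt hgu'
  have key : √(hellSq μ u u') * (1 - √κ * (1 + q)) ≤ (2 * (1 + q) + √K) * √Z := by
    have a1 : √(hellSq μ s u) ≤ √Z + √κ * √(hellSq μ u u') := by linarith
    have a2 : q * √(hellSq μ s g) ≤ q * (√(hellSq μ s u) + √Z) :=
      mul_le_mul_of_nonneg_left (by linarith) hq
    have a3 : (1 + q) * √(hellSq μ s u) ≤ (1 + q) * (√Z + √κ * √(hellSq μ u u')) :=
      mul_le_mul_of_nonneg_left a1 (by linarith)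
    linarith
  have hpos : 0 < 1 - √κ * (1 + q) := by linarith
  have key2 : √(hellSq μ u u') ≤ (2 * (1 + q) + √K) / (1 - √κ * (1 + q)) * √Z := by
    rw [div_mul_eq_mul_div, le_div_iff₀ hpos]
    exact key
  calc hellSq μ u u' = √(hellSq μ u u') ^ 2 := (Real.sq_sqrt (hellSq_nonneg μ u u')).symm
    _ ≤ ((2 * (1 + q) + √K) / (1 - √κ * (1 + q)) * √Z) ^ 2 := by gcongr
    _ = _ := by rw [mul_pow, Real.sq_sqrt hZ]

end Geometry

section Search

variable {X : Type*} [MeasurableSpace X] {μ : Measure X} {d n : ℕ} {f : (Fin d → ℝ) → X → ℝ}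
  {m M α Rlow Rup ε : Fin d → ℝ} {x : Fin n → X} {κ κ₀ : ℝ} {N : ℕ} {Θ : ℕ → Set (Fin d → ℝ)}

lemma IsNestedSearch.step_subset (h : IsNestedSearch μ x f m M ε κ κ₀ N Θ) {i : ℕ}
    (hi : i ∈ Set.Ico 1 N) : Θ (i + 1) ⊆ Θ i := by
  obtain ⟨_, _, _, _, _, _, h1, _⟩ := h.step i hi
  exact h1

lemma IsNestedSearch.last_subset (h : IsNestedSearch μ x f m M ε κ κ₀ N Θ) {i : ℕ}
    (hi : 1 ≤ i) (hiN : i ≤ N) : Θ N ⊆ Θ i :=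
  Nat.decreasingInduction' (P := fun k => Θ N ⊆ Θ k)
    (fun _ hk hik ih => ih.trans (h.step_subset ⟨hi.trans hik, hk⟩)) hiN subset_rfl

/-- A point that does not survive the search is removed at some step. -/
lemma IsNestedSearch.exists_removable (h : IsNestedSearch μ x f m M ε κ κ₀ N Θ)
    {θ₀ : Fin d → ℝ} (hθ₀ : θ₀ ∈ Set.Icc m M) (hN : θ₀ ∉ Θ N) :
    ∃ i ∈ Set.Ico 1 N, θ₀ ∈ Θ i ∧ ∃ θ ∈ Θ i, ∃ θ' ∈ Θ i,
      θ₀ ∈ removable μ f κ (Θ i) (gridTest μ x f m ε θ θ') θ θ' ∧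
      κ₀ * hellDiam μ f (Θ i) ≤ hellSq μ (f θ) (f θ') := by
  obtain ⟨i, hi, hin, hout⟩ : ∃ i ∈ Set.Ico 1 N, θ₀ ∈ Θ i ∧ θ₀ ∉ Θ (i + 1) := by
    by_contra! hcon
    exact hN (Nat.le_induction (m := 1) (P := fun k _ => k ≤ N → θ₀ ∈ Θ k)
      (fun _ => h.first ▸ hθ₀)
      (fun k hk ih hkN => hcon k ⟨hk, hkN⟩ (ih (Nat.le_of_succ_le hkN))) N h.one_le le_rfl)
  obtain ⟨L, _, θ, θ', hmem, hdiff, _, hdiam⟩ := h.step i hi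
  have hrem : θ₀ ∈ ⋃ l, removable μ f κ (Θ i) (gridTest μ x f m ε (θ l) (θ' l)) (θ l) (θ' l) := by
    by_contra hno
    exact hout (hdiff ⟨hin, hno⟩)
  obtain ⟨l, hl⟩ := Set.mem_iUnion.mp hrem
  exact ⟨i, hi, hin, θ l, (hmem l).1, θ' l, (hmem l).2.1, hl,
    hdiam.trans (ciInf_le (Set.finite_range _).bddBelow l)⟩

lemma infHellSq_le (s : X → ℝ) {A : Set (Fin d → ℝ)} {θ : Fin d → ℝ} (hθ : θ ∈ A) :
    infHellSq μ s f A ≤ hellSq μ s (f θ) :=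
  csInf_le ⟨0, by rintro _ ⟨θ', _, rfl⟩; exact hellSq_nonneg _ _ _⟩ ⟨θ, hθ, rfl⟩

lemma infHellSq_nonneg (s : X → ℝ) (A : Set (Fin d → ℝ)) : 0 ≤ infHellSq μ s f A :=
  Real.sInf_nonneg (by rintro _ ⟨θ', _, rfl⟩; exact hellSq_nonneg _ _ _)

lemma IsModel.hellSq_le_hellDiam (hf : IsModel μ f m M α Rlow Rup) {A : Set (Fin d → ℝ)}
    (hA : A ⊆ Set.Icc m M) {θ θ' : Fin d → ℝ} (hθ : θ ∈ A) (hθ' : θ' ∈ A) :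
    hellSq μ (f θ) (f θ') ≤ hellDiam μ f A := by
  refine le_csSup ⟨1, ?_⟩ (Set.mem_image2_of_mem hθ hθ')
  rintro _ ⟨θ₁, h₁, θ₂, h₂, rfl⟩
  exact hellSq_le_one (hf.isDensity _ (hA h₁)) (hf.isDensity _ (hA h₂))

/-- If removing a good approximation `θ₀` of `s` forces the tested points to be close, then the last
set of the search is close to `s`: the diameter condition applies to the set from which `θ₀` is
removed, and that set contains the last one. -/
lemma IsNestedSearch.infHellSq_last_le (h : IsNestedSearch μ x f m M ε κ κ₀ N Θ)
    (hf : IsModel μ f m M α Rlow Rup) {s : X → ℝ} (hs : IsDensity μ s) (hκ₀ : 0 < κ₀)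
    {θ₀ : Fin d → ℝ} (hθ₀ : θ₀ ∈ Set.Icc m M) {K Z : ℝ} (hK : 0 ≤ K) (hZ : 0 ≤ Z)
    (h₀ : hellSq μ s (f θ₀) ≤ Z)
    (htest : ∀ θ ∈ Set.Icc m M, ∀ θ' ∈ Set.Icc m M, 0 ≤ gridTest μ x f m ε θ θ' →
      hellSq μ (f θ₀) (f θ) ≤ κ * hellSq μ (f θ) (f θ') → hellSq μ (f θ) (f θ') ≤ K * Z) :
    infHellSq μ s f (Θ N) ≤ (2 + 2 * (K / κ₀)) * Z := by
  have hKκ : 0 ≤ K / κ₀ * Z := by positivity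
  by_cases hN : θ₀ ∈ Θ N
  · have := (infHellSq_le (μ := μ) (f := f) s hN).trans h₀
    linarith
  obtain ⟨i, hi, hin, θ, hθ, θ', hθ', hrem, hdiam⟩ := h.exists_removable hθ₀ hN
  have hsub := h.subset i ⟨hi.1, hi.2.le⟩
  have hle : hellSq μ (f θ) (f θ') ≤ K * Z := by
    rcases mem_removable hrem with ⟨hT, hc⟩ | ⟨hT, hc⟩
    · exact htest θ (hsub hθ) θ' (hsub hθ') hT hc
    · rw [hellSq_comm]
      refine htest θ' (hsub hθ') θ (hsub hθ) ?_ (by rwa [hellSq_comm μ (f θ') (f θ)])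
      rw [gridTest, testStat_swap]
      exact neg_nonneg.mpr hT
  obtain ⟨θN, hθN⟩ := h.nonempty N ⟨h.one_le, le_rfl⟩
  have hθNi := h.last_subset hi.1 hi.2.le hθN
  have h1 := hf.hellSq_le_hellDiam hsub hin hθNi
  have h2 : hellDiam μ f (Θ i) ≤ K / κ₀ * Z := by
    rw [div_mul_eq_mul_div, le_div_iff₀ hκ₀, mul_comm]
    exact hdiam.trans hle
  have h3 := hellSq_le_two_mul_add hs (hf.isDensity _ hθ₀) (hf.isDensity _ (hsub hθNi))
  have h4 := infHellSq_le (μ := μ) (f := f) s hθN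
  linarith

end Search

/-! ### The constants -/

/-- The constant `κ̄` equals `(2 + √2)⁻²`, which leaves room for some `q > 1 + √2`. -/
lemma exists_gt_of_lt_kappaBar {κ : ℝ} (hκ : 0 < κ) (hκ' : κ < kappaBar) :
    ∃ q : ℝ, 1 + √2 < q ∧ √κ * (1 + q) < 1 := by
  have h2 : √2 ^ 2 = 2 := Real.sq_sqrt (by norm_num)
  have h1 : 1 < √2 := by rw [Real.lt_sqrt] <;> norm_num
  have hlt : √2 < 2 := by nlinarith
  have e1 : √((2 + √2) / (2 - √2)) = 1 + √2 := by
    rw [Real.sqrt_eq_iff_eq_sq (div_nonneg (by linarith) (by linarith)) (by linarith),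
      div_eq_iff (by linarith)]
    nlinarith
  rw [kappaBar, e1] at hκ'
  have hs : √κ < (1 + (1 + √2))⁻¹ := by
    rw [Real.sqrt_lt' (by positivity), inv_pow]
    exact hκ'
  have hsk : 0 < √κ := Real.sqrt_pos.mpr hκ
  have h3 : 1 + √2 < (√κ)⁻¹ - 1 := by
    have := (lt_inv_comm₀ hsk (by positivity)).mp hs
    linarith
  obtain ⟨q, hq1, hq2⟩ := exists_between h3
  refine ⟨q, hq1, ?_⟩
  calc √κ * (1 + q) < √κ * (√κ)⁻¹ := by gcongr; linarith
    _ = 1 := mul_inv_cancel₀ hsk.ne'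

lemma exists_test_margin {q : ℝ} (hq : 1 + √2 < q) :
    ∃ η : ℝ, 0 < η ∧ η ≤ 1 ∧ 0 < √2 - 1 - 2 * η ∧
      √2 + 1 + 2 * η ≤ q ^ 2 * (√2 - 1 - 2 * η) := by
  have h2 : √2 ^ 2 = 2 := Real.sq_sqrt (by norm_num)
  have h1 : 1 < √2 := by rw [Real.lt_sqrt] <;> norm_num
  have hlt : √2 < 2 := by nlinarith
  have hδ : 0 < q ^ 2 * (√2 - 1) - (√2 + 1) := by
    have : (1 + √2) ^ 2 < q ^ 2 := by gcongr
    nlinarith [mul_pos (sub_pos.mpr this) (sub_pos.mpr h1)]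
  have hq1 : 0 < 2 * (1 + q ^ 2) := by positivity
  set η := (q ^ 2 * (√2 - 1) - (√2 + 1)) / (2 * (1 + q ^ 2)) with hη
  have e : η * (2 * (1 + q ^ 2)) = q ^ 2 * (√2 - 1) - (√2 + 1) := div_mul_cancel₀ _ hq1.ne'
  have hη0 : 0 < η := div_pos hδ hq1
  have hlt' : 0 < √2 - 1 - 2 * η := by
    by_contra! hcon
    nlinarith [mul_nonneg (sub_nonneg.mpr (sub_nonpos.mp hcon)) (by positivity : 0 ≤ 1 + q ^ 2)]
  exact ⟨η, hη0, by linarith, hlt', by linarith⟩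

/-- On the event where all the tests between grid points are close to their means, a non-negative
test compares the two discretized densities up to the target risk `Z`. -/
lemma hellSq_le_of_testStat_bound {η q ξ Z D H H₀ H' n T : ℝ} (hn : 0 < n) (hη : 0 < η)
    (hη' : 0 < √2 - 1 - 2 * η) (hq : √2 + 1 + 2 * η ≤ q ^ 2 * (√2 - 1 - 2 * η))
    (hH : 0 ≤ H) (hξ : ξ ≤ Z) (hD : D / n ≤ Z) (hH₀ : H₀ ≤ 4 * Z) (hT : 0 ≤ T)
    (h : T < (√2 + 1) * H - (√2 - 1) * H' + 6 * (η / 6) * (H + H')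
      + (n * ξ + n * (η / 6 * η) * (H + H') + 2 * (n * (η / 6 * η) * H₀ + 4 * D))
        / (n * (η / 6))) :
    H' ≤ q ^ 2 * H + (54 / η + 8 * η) / (√2 - 1 - 2 * η) * Z := by
  have e1 : (n * ξ + n * (η / 6 * η) * (H + H') + 2 * (n * (η / 6 * η) * H₀ + 4 * D))
        / (n * (η / 6)) = 6 / η * ξ + η * (H + H') + 2 * η * H₀ + 48 / η * (D / n) := by
    field_simp
    ring
  rw [e1] at h
  have h1 : 6 / η * ξ ≤ 6 / η * Z := by gcongr
  have h2 : 2 * η * H₀ ≤ 2 * η * (4 * Z) := by gcongr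
  have h3 : 48 / η * (D / n) ≤ 48 / η * Z := by gcongr
  have h4 : 6 / η * Z + 48 / η * Z = 54 / η * Z := by ring
  have h5 : (√2 - 1 - 2 * η) * H' ≤
      q ^ 2 * (√2 - 1 - 2 * η) * H + (54 / η + 8 * η) * Z := by
    nlinarith [mul_le_mul_of_nonneg_right hq hH]
  rw [← mul_le_mul_iff_right₀ hη']
  refine h5.trans (le_of_eq ?_)
  field_simp

end HellingerTest

end

open HellingerTest in
theorem theorem4 (κ : ℝ) (hκ : 0 < κ) (hκ' : κ < HellingerTest.kappaBar) :
    ∃ c : ℝ, 0 < c ∧ ∀ κ₀ : ℝ, 0 < κ₀ → ∃ C : ℝ, 0 < C ∧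
      ∀ {𝕏 : Type*} [MeasurableSpace 𝕏] (μ : Measure 𝕏)
        {Ω : Type*} [MeasurableSpace Ω] (P : Measure Ω) [IsProbabilityMeasure P]
        (n : ℕ) (_hn : 1 ≤ n) (X : Fin n → Ω → 𝕏) (_hX : ∀ i, Measurable (X i))
        (_hindep : iIndepFun X P)
        (s : 𝕏 → ℝ) (_hs : HellingerTest.IsDensity μ s)
        (_hlaw : ∀ i, P.map (X i) = μ.withDensity (fun x => ENNReal.ofReal (s x)))
        (d : ℕ) (_hd : 1 ≤ d) (m M α Rlow Rup : Fin d → ℝ) (f : (Fin d → ℝ) → 𝕏 → ℝ)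
        (_hf : HellingerTest.IsModel μ f m M α Rlow Rup)
        (t : Fin d → ℝ) (_ht : ∀ j, 0 < t j ∧ t j ≤ (d : ℝ) ^ (1 / α j))
        (N : Ω → ℕ) (Θ : Ω → ℕ → Set (Fin d → ℝ))
        (_hΘ : ∀ ω, HellingerTest.IsNestedSearch μ (fun i => X i ω) f m M
          (HellingerTest.mesh n t α Rup) κ κ₀ (N ω) (Θ ω))
        (ξ : ℝ) (_hξ : 0 < ξ),
        P {ω | HellingerTest.infHellSq μ s f (Set.Icc m M)
              + HellingerTest.dimTerm c t α Rlow Rup / n + ξ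
            ≤ C * HellingerTest.infHellSq μ s f (Θ ω (N ω))}
          ≤ ENNReal.ofReal (Real.exp (-(n * ξ))) := by
  obtain ⟨q, hq, hκq⟩ := exists_gt_of_lt_kappaBar hκ hκ'
  obtain ⟨η, hη, hη1, hη2, hηq⟩ := exists_test_margin hq
  have hq0 : 0 ≤ q := by linarith [Real.sqrt_nonneg 2]
  refine ⟨4 / (η / 6 * η), by positivity, fun κ₀ hκ₀ => ?_⟩
  set K := (54 / η + 8 * η) / (√2 - 1 - 2 * η) with hKdef
  have hK : 0 ≤ K := by positivity
  set K' := ((2 * (1 + q) + √K) / (1 - √κ * (1 + q))) ^ 2 with hKdef'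
  have hK' : 0 ≤ K' := sq_nonneg _
  have hKκ : 0 ≤ K' / κ₀ := by positivity
  -- the numerical constant exceeds `2 + 2 (K' / κ₀)`, so that the final inequality is strict
  refine ⟨(3 + 2 * (K' / κ₀))⁻¹, by positivity, ?_⟩
  intro 𝕏 _ μ Ω _ P _ n hn X hX hindep s hs hlaw d hd m M α Rlow Rup f hf t ht N Θ hΘ ξ hξ
  have hn0 : (0 : ℝ) < n := by exact_mod_cast hn
  have hd0 : (1 : ℝ) ≤ d := by exact_mod_cast hd
  obtain ⟨ω₀⟩ : Nonempty Ω := P.nonempty_of_neZero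
  have hne : (Set.Icc m M).Nonempty :=
    (hΘ ω₀).first ▸ (hΘ ω₀).nonempty 1 ⟨le_rfl, (hΘ ω₀).one_le⟩
  have hmM : m ≤ M := Set.nonempty_Icc.mp hne
  have ht0 : ∀ j, 0 < t j := fun j => (ht j).1
  have hε := hf.mesh_pos hn ht0
  set D := dimTerm (4 / (η / 6 * η)) t α Rlow Rup with hDdef
  set Z := infHellSq μ s f (Set.Icc m M) + D / n + ξ with hZdef
  have hdD : (d : ℝ) / n ≤ D / n := by
    gcongr
    exact le_dimTerm _ _ _ _ _
  have h1n : 1 / (n : ℝ) ≤ d / n := by gcongr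
  have h1n0 : 0 < 1 / (n : ℝ) := by positivity
  have hinf := infHellSq_nonneg (μ := μ) (f := f) s (Set.Icc m M)
  have hZ : 0 < Z := by linarith
  -- a point of the rectangle that minimises `h²(s, f_θ)` up to `1 / n`
  obtain ⟨_, ⟨θ₀, hθ₀, rfl⟩, hlt⟩ := exists_lt_of_csInf_lt (hne.image fun θ => hellSq μ s (f θ))
    (show infHellSq μ s f (Set.Icc m M) < infHellSq μ s f (Set.Icc m M) + 1 / n by linarith)
  have h₀ : hellSq μ s (f θ₀) ≤ Z := by
    dsimp only at hlt
    linarith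
  obtain ⟨k₀, hk₀, hk₀θ⟩ := exists_gridProj_eq hε hθ₀
  have hden : ∀ k ∈ gridIndex m M (mesh n t α Rup),
      IsDensity μ (f (gridPoint m (mesh n t α Rup) k)) :=
    fun k hk => hf.isDensity _ (gridPoint_mem_Icc hmM hε hk)
  have hproj : ∀ θ ∈ Set.Icc m M, hellSq μ (f θ) (f (gridProj m (mesh n t α Rup) θ)) ≤ Z :=
    fun θ hθ => (hf.hellSq_gridProj_le hn hd ht hθ).trans (by linarith)
  have hH₀ : hellSq μ s (f (gridPoint m (mesh n t α Rup) k₀)) ≤ 4 * Z := by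
    have h1 := hellSq_le_two_mul_add hs (hf.isDensity _ hθ₀) (hden k₀ hk₀)
    have h2 := hproj θ₀ hθ₀
    rw [hk₀θ] at h2
    linarith
  refine le_trans (measure_mono ?_) (hf.measure_exists_testStat_ge_le hs hn hX hindep hlaw hd ht0
    (a := η / 6 * η) (l := η / 6) (by positivity) (by positivity) (by linarith) hmM hk₀ ξ
    fun _ => rfl)
  intro ω hω
  by_contra hgood
  rw [Set.mem_ofPred_eq] at hω hgood
  push Not at hgood
  have hlast : infHellSq μ s f (Θ ω (N ω)) ≤ (2 + 2 * (K' / κ₀)) * Z := by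
    refine (hΘ ω).infHellSq_last_le hf hs hκ₀ hθ₀ hK' hZ.le h₀ fun θ hθ θ' hθ' hT hclose => ?_
    obtain ⟨k, hk, hkθ⟩ := exists_gridProj_eq hε hθ
    obtain ⟨k', hk', hkθ'⟩ := exists_gridProj_eq hε hθ'
    have hg := hproj θ hθ
    have hg' := hproj θ' hθ'
    rw [hkθ] at hg
    rw [hkθ'] at hg'
    rw [gridTest, hkθ, hkθ'] at hT
    exact hellSq_le_of_close_to_loser hs (hf.isDensity _ hθ₀) (hf.isDensity _ hθ)
      (hf.isDensity _ hθ') (hden k hk) (hden k' hk') hκ.le hq0 hK hZ.le hκq h₀ hg hg'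
      (hellSq_le_of_testStat_bound hn0 hη hη2 hηq (hellSq_nonneg _ _ _) (by linarith)
        (by linarith) hH₀ hT (hgood k hk k' hk')) hclose
  rw [← div_eq_inv_mul, le_div_iff₀ (by positivity)] at hω
  linarith
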